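/- **Theorem (Gap-independent regret upper bound).** *Setting.* Let $\mathcal A=\{a_1,\dots,a_n\}$ be a set of $n$ arms and let $\mathcal S$ be the family of its $k$-element subsets. For each $s\in\mathcal S$ let a joint law of rewards $X_{i,s}\in\{0,1\}$, $a_i\in s$, be given (it may depend on $s$, and the rewards within a set may be dependent). Put $P(a_i\mid s)=\mathbb E[X_{i,s}]$ and $Q(s)=\sum_{a_i\in s}X_{i,s}$. In round $t=1,\dots,T$ a learner selects $s(t)\in\mathcal S$; given the past and $s(t)=s$, the rewards of the arms in $s$ are drawn afresh from the law attached to $s$, and are observed. Let $s^*\in\mathcal S$ maximize $\mathbb E[Q(s)]$ over $\mathcal S$, and let $R(T)=\sum_{t=1}^{T}\mathbb E[Q(s^*)-Q(s(t))]$. *Weak optimal set consistency.* For every $s\in\mathcal S$ with $s\ne s^*$ and every $a\in s\cap s^*$, $P(a\mid s)\ge P(a\mid s^*)$. *Algorithm (UCB with parameter $\alpha$, set size $k$, horizon $T$).* Before round $t$ let $N_i(t)$ be the number of earlier rounds in which $a_i$ was selected and $C_i(t)$ the sum of the rewards of $a_i$ in these rounds. Put $\mathrm{UCB}_i(t)=+\infty$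 if $N_i(t)=0$, and $\mathrm{UCB}_i(t)=\frac{C_i(t)}{N_i(t)}+\sqrt{\frac{\alpha\log T}{N_i(t)}}$ otherwise. In round $t$ select a set $s(t)$ of $k$ arms with the top-$k$ values of $\mathrm{UCB}_i(t)$; ties are broken by any, possibly randomized, rule that depends only on the past (for example uniformly at random). *Claim.* Under weak optimal set consistency, for all $T\ge 2$ and $\alpha\ge 2$, the algorithm satisfies $$R(T)\le 2\sqrt{\alpha k n T\log T}+15k^2\sqrt{\alpha n T\log T}=O\!\left(k^2\sqrt{\alpha n T\log T}\right),$$ where the constant in $O(\cdot)$ is absolute. In particular the bound does not depend on the gap $\epsilon=\min_{s\in\mathcal S,\,s\ne s^*}\mathbb E[Q(s^*)-Q(s)]$. -/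

import Mathlib

namespace CombBandit

/-- One round of play: the selected set of arms `s` together with the observed binary rewards
`X_{i,s}`, one for each arm `i` of `s` (`true` stands for the reward `1`). -/
abbrev Round (n : ℕ) : Type := (s : Finset (Fin n)) × (s → Bool)

/-- The first `t` rounds of play. -/
abbrev History (n t : ℕ) : Type := Fin t → Round n

/-- A reward model: for every set `s`, the joint law of the binary rewards of the arms in `s`.
The law may depend on `s`, and rewards of different arms may depend on each other. -/
abbrev RewardModel (n : ℕ) : Type := (s : Finset (Fin n)) → PMF (s → Bool)

/-- A (possibly randomized) selection rule: the law of the next selected set given the past. -/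
abbrev Policy (n : ℕ) : Type := (t : ℕ) → History n t → PMF (Finset (Fin n))

/-- The reward of arm `i` in a round (`0` if the arm was not selected). -/
def Round.reward {n : ℕ} (r : Round n) (i : Fin n) : ℝ :=
  if hi : i ∈ r.1 then (if r.2 ⟨i, hi⟩ = true then 1 else 0) else 0

/-- The total reward `Q(s)` collected in a round. -/
def Round.total {n : ℕ} (r : Round n) : ℝ := ∑ i ∈ r.1, r.reward i

/-- Expectation of a real function under a law on a finite type. -/
noncomputable def expect {β : Type*} [Fintype β] (p : PMF β) (f : β → ℝ) : ℝ :=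
  ∑ b, (p b).toReal * f b

/-- `P(a_i | s) = E[X_{i,s}]` (only meaningful for `i ∈ s`). -/
noncomputable def RewardModel.mean {n : ℕ} (D : RewardModel n) (s : Finset (Fin n))
    (i : Fin n) : ℝ :=
  expect (D s) fun x => Round.reward ⟨s, x⟩ i

/-- The expected total reward `E[Q(s)]` of a set `s`. -/
noncomputable def RewardModel.value {n : ℕ} (D : RewardModel n) (s : Finset (Fin n)) : ℝ :=
  expect (D s) fun x => Round.total ⟨s, x⟩

/-- The sets the learner may select: the `k`-element sets of arms. -/
def feasible (n k : ℕ) : Finset (Finset (Fin n)) := Finset.powersetCard k Finset.univ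

/-- `sStar` maximizes the expected total reward among the `k`-element sets. -/
def IsOptimal {n : ℕ} (D : RewardModel n) (k : ℕ) (sStar : Finset (Fin n)) : Prop :=
  sStar ∈ feasible n k ∧ ∀ s ∈ feasible n k, D.value s ≤ D.value sStar

/-- Weak optimal set consistency: an arm of the optimal set `sStar` has at least the same
expected reward in every other `k`-element set that contains it. -/
def WeakOptimalSetConsistency {n : ℕ} (D : RewardModel n) (k : ℕ)
    (sStar : Finset (Fin n)) : Prop :=
  ∀ s ∈ feasible n k, s ≠ sStar → ∀ a ∈ s ∩ sStar, D.mean sStar a ≤ D.mean s a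

/-- `N_i`: the number of past rounds in which arm `i` was selected. -/
def numPulls {n t : ℕ} (h : History n t) (i : Fin n) : ℕ :=
  (Finset.univ.filter fun τ : Fin t => i ∈ (h τ).1).card

/-- `C_i`: the cumulative reward of arm `i`. -/
def cumReward {n t : ℕ} (h : History n t) (i : Fin n) : ℝ := ∑ τ, (h τ).reward i

/-- The index `UCB_i` with parameter `α` and horizon `T`; it is infinite before the first
selection of arm `i`. As `N_i` and `C_i` change only in the rounds in which `i` is selected, so
does the index. -/
noncomputable def ucb {n t : ℕ} (α : ℝ) (T : ℕ) (h : History n t) (i : Fin n) : EReal :=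
  if numPulls h i = 0 then ⊤
  else ((cumReward h i / numPulls h i + √(α * Real.log T / numPulls h i) : ℝ) : EReal)

/-- `s` consists of `k` arms with the top-`k` values of the index `U`. -/
def IsTopK {n : ℕ} (k : ℕ) (U : Fin n → EReal) (s : Finset (Fin n)) : Prop :=
  s ∈ feasible n k ∧ ∀ i ∈ s, ∀ j ∉ s, U j ≤ U i

/-- `π` is a run of the UCB algorithm with parameter `α`, set size `k` and horizon `T`: in each of
the `T` rounds a set with the top-`k` indices is selected. Ties may be broken by any rule, in
particular uniformly at random; the rule may use the past and additional randomness. -/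
def IsUCBAlgorithm {n : ℕ} (α : ℝ) (k T : ℕ) (π : Policy n) : Prop :=
  ∀ t < T, ∀ h : History n t, ∀ s ∈ (π t h).support, IsTopK k (ucb α T h) s

/-- The law of the next round: select a set by `π`, then draw the rewards of its arms. -/
noncomputable def roundLaw {n : ℕ} (D : RewardModel n) (π : Policy n) {t : ℕ}
    (h : History n t) : PMF (Round n) :=
  (π t h).bind fun s => (D s).map fun x => ⟨s, x⟩

/-- The law of the first `t` rounds when `π` is run on the reward model `D`. -/
noncomputable def historyLaw {n : ℕ} (D : RewardModel n) (π : Policy n) :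
    (t : ℕ) → PMF (History n t)
  | 0 => PMF.pure Fin.elim0
  | t + 1 => (historyLaw D π t).bind fun h =>
      (roundLaw D π h).map fun r => (Fin.snoc h r : History n (t + 1))

/-- `E[Q(s*) - Q(s(t))]`, the regret of the round with (zero-based) number `t`. -/
noncomputable def stepRegret {n : ℕ} (D : RewardModel n) (π : Policy n)
    (sStar : Finset (Fin n)) (t : ℕ) : ℝ :=
  D.value sStar - expect (historyLaw D π (t + 1)) fun h => (h (Fin.last t)).total

/-- `R(T)`, the total regret of the first `T` rounds. -/
noncomputable def regret {n : ℕ} (D : RewardModel n) (π : Policy n)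
    (sStar : Finset (Fin n)) (T : ℕ) : ℝ :=
  ∑ t ∈ Finset.range T, stepRegret D π sStar t

end CombBandit

/-! Write `p j` for the mean of arm `j` in the optimal set and call it the level of `j`. No gap is
needed because the regret is compared with a few fixed levels, and each level is active only during
an initial stretch of time.

Activity is monotone (`Active.of_snoc`): a round changes only the indices of the arms it plays, so a
level once above the indices of all unselected arms stays there. While a level `p` is active, every
selected arm has index at least `p`, which gives `p * N - C ≤ √(α log T * N)`. Since the active
rounds form a prefix, the accumulated shortfall of each arm obeys a pathwise bound of this order
(`totalShortfall_le`), and Cauchy-Schwarz with `∑ N = k * T` sums it over arms.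

In a single round, each optimal arm that is not selected either has an active level or has an index
below its mean. `regret_le_sum_shortfall` turns this into a bound on the regret by shortfalls at
active levels plus `k` times the number of arms whose index fails. Consistency enters there, and
again in the failure probability: an optimal arm has mean at least `p` in every feasible set, so an
exponential supermartingale and a union bound over `N` give failure probability at most `1 / T`. The
total is `2 * k * √(α log T * n * k * T) + k ^ 2`. -/

namespace CombBandit

/-! ### Finite expectations and Hoeffding's lemma -/

section Expect

variable {β γ : Type*} [Fintype β] [Fintype γ]

lemma sum_toReal (p : PMF β) : ∑ b, (p b).toReal = 1 := by
  rw [← ENNReal.toReal_sum fun b _ => p.apply_ne_top b, ← tsum_fintype (L := .unconditional _),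
    p.tsum_coe, ENNReal.toReal_one]

lemma expect_const (p : PMF β) (c : ℝ) : expect p (fun _ => c) = c := by
  simp [expect, ← Finset.sum_mul, sum_toReal]

lemma expect_add (p : PMF β) (f g : β → ℝ) :
    expect p (fun b => f b + g b) = expect p f + expect p g := by
  simp [expect, mul_add, Finset.sum_add_distrib]

lemma expect_sub (p : PMF β) (f g : β → ℝ) :
    expect p (fun b => f b - g b) = expect p f - expect p g := by
  simp [expect, mul_sub, Finset.sum_sub_distrib]

lemma expect_const_mul (p : PMF β) (c : ℝ) (f : β → ℝ) :
    expect p (fun b => c * f b) = c * expect p f := by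
  simp only [expect, Finset.mul_sum]
  exact Finset.sum_congr rfl fun _ _ => by ring

lemma expect_sum {ι : Type*} (p : PMF β) (s : Finset ι) (f : ι → β → ℝ) :
    expect p (fun b => ∑ i ∈ s, f i b) = ∑ i ∈ s, expect p (f i) := by
  simp only [expect, Finset.mul_sum]
  exact Finset.sum_comm

lemma expect_mono (p : PMF β) {f g : β → ℝ} (h : ∀ b ∈ p.support, f b ≤ g b) :
    expect p f ≤ expect p g := by
  refine Finset.sum_le_sum fun b _ => ?_
  by_cases hb : p b = 0
  · simp [hb]
  · exact mul_le_mul_of_nonneg_left (h b ((p.mem_support_iff b).2 hb)) ENNReal.toReal_nonneg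

lemma expect_pure (a : β) (f : β → ℝ) : expect (PMF.pure a) f = f a := by
  classical
  rw [expect, Finset.sum_eq_single a]
  · simp
  · intro b _ hb
    simp [PMF.pure_apply, hb]
  · simp

lemma expect_bind (p : PMF β) (q : β → PMF γ) (f : γ → ℝ) :
    expect (p.bind q) f = expect p fun b => expect (q b) f := by
  have h : ∀ c, ((p.bind q) c).toReal = ∑ b, (p b).toReal * (q b c).toReal := fun c => by
    rw [PMF.bind_apply, tsum_fintype, ENNReal.toReal_sum fun b _ =>
      ENNReal.mul_ne_top (p.apply_ne_top b) ((q b).apply_ne_top c)]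
    simp [ENNReal.toReal_mul]
  simp only [expect, h, Finset.sum_mul, Finset.mul_sum]
  rw [Finset.sum_comm]
  exact Finset.sum_congr rfl fun _ _ => Finset.sum_congr rfl fun _ _ => by ring

lemma expect_map (p : PMF β) (g : β → γ) (f : γ → ℝ) :
    expect (p.map g) f = expect p fun b => f (g b) := by
  rw [← PMF.bind_pure_comp, expect_bind]
  simp [expect_pure]

/-- Hoeffding's lemma for a function with values in the unit interval. -/
lemma expect_exp_le (p : PMF β) {f : β → ℝ} (hf : ∀ b, f b ∈ Set.Icc (0 : ℝ) 1) (l : ℝ) :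
    expect p (fun b => Real.exp (l * (expect p f - f b))) ≤ Real.exp (l ^ 2 / 8) := by
  let : MeasurableSpace β := ⊤
  have hint : ∀ g : β → ℝ, ∫ b, g b ∂p.toMeasure = expect p g := fun g => by
    rw [PMF.integral_eq_sum]
    rfl
  have h := (ProbabilityTheory.hasSubgaussianMGF_of_mem_Icc (μ := p.toMeasure) (X := f)
    (measurable_of_finite f).aemeasurable (Filter.Eventually.of_forall hf)).mgf_le (-l)
  rw [ProbabilityTheory.mgf, hint, hint] at h
  convert h using 2
  · funext b
    ring_nf
  · norm_num
    ring

end Expect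

/-! ### Histories, counts and the support of the algorithm's law -/

section History

variable {n : ℕ}

lemma expect_historyLaw_succ (D : RewardModel n) (π : Policy n) (t : ℕ)
    (F : History n (t + 1) → ℝ) :
    expect (historyLaw D π (t + 1)) F = expect (historyLaw D π t) fun h =>
      expect (π t h) fun s => expect (D s) fun x => F (Fin.snoc h ⟨s, x⟩) := by
  simp only [historyLaw, roundLaw, expect_bind, expect_map]

lemma reward_mem_Icc (r : Round n) (i : Fin n) : r.reward i ∈ Set.Icc (0 : ℝ) 1 := by
  unfold Round.reward
  split_ifs <;> simp

lemma reward_of_notMem {r : Round n} {i : Fin n} (h : i ∉ r.1) : r.reward i = 0 := by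
  simp [Round.reward, h]

lemma mean_mem_Icc (D : RewardModel n) (s : Finset (Fin n)) (i : Fin n) :
    D.mean s i ∈ Set.Icc (0 : ℝ) 1 := by
  constructor
  · rw [← expect_const (D s) 0]
    exact expect_mono _ fun x _ => (reward_mem_Icc _ i).1
  · rw [← expect_const (D s) 1]
    exact expect_mono _ fun x _ => (reward_mem_Icc _ i).2

lemma value_eq_sum_mean (D : RewardModel n) (s : Finset (Fin n)) :
    D.value s = ∑ i ∈ s, D.mean s i := by
  simp only [RewardModel.value, RewardModel.mean, Round.total, expect_sum]

lemma numPulls_snoc {t : ℕ} (h : History n t) (r : Round n) (i : Fin n) :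
    numPulls (Fin.snoc h r : History n (t + 1)) i = numPulls h i + if i ∈ r.1 then 1 else 0 := by
  simp only [numPulls, Finset.card_filter, Fin.sum_univ_castSucc, Fin.snoc_castSucc, Fin.snoc_last]

lemma cumReward_snoc {t : ℕ} (h : History n t) (r : Round n) (i : Fin n) :
    cumReward (Fin.snoc h r : History n (t + 1)) i = cumReward h i + r.reward i := by
  simp only [cumReward, Fin.sum_univ_castSucc, Fin.snoc_castSucc, Fin.snoc_last]

lemma cumReward_nonneg {t : ℕ} (h : History n t) (i : Fin n) : 0 ≤ cumReward h i :=
  Finset.sum_nonneg fun τ _ => (reward_mem_Icc (h τ) i).1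

lemma numPulls_le {t : ℕ} (h : History n t) (i : Fin n) : numPulls h i ≤ t := by
  simpa [numPulls] using Finset.card_filter_le (Finset.univ : Finset (Fin t)) fun τ => i ∈ (h τ).1

lemma ucb_snoc_of_notMem {t : ℕ} (α : ℝ) (T : ℕ) (h : History n t) {r : Round n} {i : Fin n}
    (hi : i ∉ r.1) : ucb α T (Fin.snoc h r : History n (t + 1)) i = ucb α T h i := by
  simp [ucb, numPulls_snoc, cumReward_snoc, hi, reward_of_notMem hi]

/-- Every round of the history selects a set with the top-`k` indices. -/
def FollowsUCB (α : ℝ) (k T : ℕ) : (t : ℕ) → History n t → Prop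
  | 0, _ => True
  | t + 1, h => FollowsUCB α k T t (Fin.init h) ∧
      IsTopK k (ucb α T (Fin.init h)) (h (Fin.last t)).1

lemma followsUCB_snoc {α : ℝ} {k T t : ℕ} {h : History n t} {r : Round n} :
    FollowsUCB α k T (t + 1) (Fin.snoc h r) ↔
      FollowsUCB α k T t h ∧ IsTopK k (ucb α T h) r.1 := by
  simp [FollowsUCB]

lemma followsUCB_of_mem_support {α : ℝ} {k T : ℕ} {D : RewardModel n} {π : Policy n}
    (hπ : IsUCBAlgorithm α k T π) {t : ℕ} (ht : t ≤ T) :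
    ∀ h ∈ (historyLaw D π t).support, FollowsUCB α k T t h := by
  induction t with
  | zero => exact fun _ _ => trivial
  | succ t ih =>
    intro h hh
    simp only [historyLaw, roundLaw, PMF.mem_support_bind_iff, PMF.mem_support_map_iff] at hh
    obtain ⟨h', hh', r, ⟨s, hs, x, -, rfl⟩, rfl⟩ := hh
    exact followsUCB_snoc.2 ⟨ih (by omega) h' hh', hπ t (by omega) h' s hs⟩

lemma sum_numPulls {α : ℝ} {k T t : ℕ} {h : History n t} (hh : FollowsUCB α k T t h) :
    ∑ i, numPulls h i = k * t := by
  induction t with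
  | zero => simp [numPulls]
  | succ t ih =>
    obtain ⟨h, r, rfl⟩ : ∃ h' r, h = Fin.snoc h' r := ⟨Fin.init h, h (Fin.last t), by simp⟩
    obtain ⟨hh, hr, -⟩ := followsUCB_snoc.1 hh
    simp only [numPulls_snoc, Finset.sum_add_distrib, ih hh]
    have : r.1.card = k := (Finset.mem_powersetCard.1 hr).2
    simp [this, mul_add]

end History

/-! ### Combinatorial bound for one round -/

/-- The regret of a single round is bounded by the shortfalls of the selected arms with respect to
the levels `p j` of the elements `j` of `J`. Here `p` and `x` stand for the mean rewards in the
optimal set `sStar` and in the selected set `s`. -/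
lemma regret_le_sum_shortfall {ι : Type*} [DecidableEq ι] {sStar s J B : Finset ι} {p x : ι → ℝ}
    (hcard : s.card = sStar.card) (hp : ∀ j, p j ∈ Set.Icc (0 : ℝ) 1)
    (hx : ∀ i, 0 ≤ x i) (hpx : ∀ c ∈ s ∩ sStar, p c ≤ x c)
    (hopt : ∑ i ∈ s, x i ≤ ∑ j ∈ sStar, p j) (hJ : J ⊆ sStar) (hB : B ⊆ sStar)
    (hJB : sStar \ s ⊆ J ∪ B) :
    ∑ j ∈ sStar, p j - ∑ i ∈ s, x i ≤
      ∑ j ∈ J, ∑ i ∈ s \ sStar.filter (fun c => p j < p c), (p j - x i) +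
        (sStar.card : ℝ) * B.card := by
  have hBle : ∀ f : ι → ℝ, (∀ c, f c ≤ 1) → ∑ c ∈ B, f c ≤ B.card := fun f hf => by
    simpa using Finset.sum_le_sum fun c (_ : c ∈ B) => hf c
  rcases J.eq_empty_or_nonempty with rfl | hne
  · rw [Finset.empty_union] at hJB
    have h1 : ∑ j ∈ sStar ∩ s, p j ≤ ∑ i ∈ s, x i := by
      rw [Finset.inter_comm]
      exact (Finset.sum_le_sum hpx).trans
        (Finset.sum_le_sum_of_subset_of_nonneg Finset.inter_subset_left fun i _ _ => hx i)
    have h2 : ∑ j ∈ sStar \ s, p j ≤ B.card :=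
      (Finset.sum_le_sum_of_subset_of_nonneg hJB fun i _ _ => (hp i).1).trans
        (hBle p fun c => (hp c).2)
    have h3 := Finset.sum_inter_add_sum_sdiff sStar s p
    have h4 : (B.card : ℝ) ≤ (sStar.card : ℝ) * B.card := by
      rcases B.eq_empty_or_nonempty with rfl | hBne
      · simp
      · have : (1 : ℝ) ≤ sStar.card := by exact_mod_cast (hBne.mono hB).card_pos
        exact le_mul_of_one_le_left (by positivity) this
    simp only [Finset.sum_empty]
    linarith
  -- Equal cardinalities make the shortfall of all of `s` at level `p j` equal to the regret plus `∑
  -- c ∈ sStar, (p j - p c)`. Dropping the selected optimal arms above the level restores at least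
  -- their excess `p c - p j`, by `hpx`. The excess of the missing optimal arms remains; it is paid
  -- by `J` and, at most 1 per arm, by `B`.
  · have key : ∀ j ∈ J, ∑ j ∈ sStar, p j - ∑ i ∈ s, x i + ∑ c ∈ J, max (p j - p c) 0
        - ∑ c ∈ J, max (p c - p j) 0 - B.card ≤
          ∑ i ∈ s \ sStar.filter (fun c => p j < p c), (p j - x i) := by
      intro j _
      have e1 := Finset.sum_inter_add_sum_sdiff s (sStar.filter fun c => p j < p c)
        (fun i => p j - x i)
      have e2 : ∑ i ∈ s ∩ sStar.filter (fun c => p j < p c), (p j - x i) ≤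
          - ∑ c ∈ sStar ∩ s, max (p c - p j) 0 := by
        have : ∑ c ∈ sStar ∩ s, max (p c - p j) 0 =
            ∑ c ∈ s ∩ sStar.filter (fun c => p j < p c), (p c - p j) := by
          rw [Finset.inter_comm, show s ∩ sStar.filter (fun c => p j < p c) =
            (s ∩ sStar).filter (fun c => p j < p c) by ext; simp [and_assoc], Finset.sum_filter]
          refine Finset.sum_congr rfl fun c _ => ?_
          split_ifs with h
          · exact max_eq_left (by linarith)
          · exact max_eq_right (by linarith)
        rw [this, ← Finset.sum_neg_distrib]
        refine Finset.sum_le_sum fun c hc => ?_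
        have := hpx c (Finset.mem_inter.2 ⟨(Finset.mem_inter.1 hc).1,
          (Finset.mem_filter.1 (Finset.mem_inter.1 hc).2).1⟩)
        linarith
      have e3 : ∑ i ∈ s, (p j - x i) =
          ∑ j ∈ sStar, p j - ∑ i ∈ s, x i + ∑ c ∈ sStar, (p j - p c) := by
        simp only [Finset.sum_sub_distrib, Finset.sum_const, hcard]
        ring
      have e4 : ∑ c ∈ sStar, (p j - p c) =
          ∑ c ∈ sStar, max (p j - p c) 0 - ∑ c ∈ sStar, max (p c - p j) 0 := by
        rw [← Finset.sum_sub_distrib]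
        refine Finset.sum_congr rfl fun c _ => ?_
        rcases le_total (p c) (p j) with h | h
        · rw [max_eq_left (by linarith), max_eq_right (by linarith)]
          ring
        · rw [max_eq_right (by linarith), max_eq_left (by linarith)]
          ring
      have e5 := Finset.sum_inter_add_sum_sdiff sStar s (fun c => max (p c - p j) 0)
      have e6 : ∑ c ∈ sStar \ s, max (p c - p j) 0 ≤ ∑ c ∈ J, max (p c - p j) 0 + B.card := by
        have h1 := Finset.sum_le_sum_of_subset_of_nonneg hJB
          fun c _ _ => le_max_right (p c - p j) 0
        have h2 := Finset.sum_union_inter (s₁ := J) (s₂ := B) (f := fun c => max (p c - p j) 0)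
        have h3 : 0 ≤ ∑ c ∈ J ∩ B, max (p c - p j) 0 :=
          Finset.sum_nonneg fun c _ => le_max_right _ _
        have h4 := hBle (fun c => max (p c - p j) 0) fun c =>
          max_le (by linarith [(hp c).2, (hp j).1]) zero_le_one
        linarith
      have e7 : ∑ c ∈ J, max (p j - p c) 0 ≤ ∑ c ∈ sStar, max (p j - p c) 0 :=
        Finset.sum_le_sum_of_subset_of_nonneg hJ fun c _ _ => le_max_right _ _
      linarith
    have hsum := Finset.sum_le_sum key
    -- Summed over all levels in `J`, the two positive-part corrections cancel by symmetry. This is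
    -- why every active level is used rather than one.
    have hcomm : ∑ j ∈ J, ∑ c ∈ J, max (p j - p c) 0 = ∑ j ∈ J, ∑ c ∈ J, max (p c - p j) 0 :=
      Finset.sum_comm
    simp only [Finset.sum_sub_distrib, Finset.sum_add_distrib, Finset.sum_const, nsmul_eq_mul]
      at hsum hcomm ⊢
    have h1 : (1 : ℝ) ≤ J.card := by exact_mod_cast hne.card_pos
    have h2 : (J.card : ℝ) ≤ sStar.card := by exact_mod_cast Finset.card_le_card hJ
    -- The sum over `J` bounds `J.card` copies of the regret; one copy suffices because the regret
    -- is nonnegative.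
    have h3 := le_mul_of_one_le_left (sub_nonneg.2 hopt) h1
    have h4 := mul_le_mul_of_nonneg_right h2 (Nat.cast_nonneg (α := ℝ) B.card)
    linarith

variable {n : ℕ}

/-! ### Active levels and the pathwise shortfall bound -/

/-- The level `p` is active in a round that selects `s` after the history `h` if the index of some
arm outside `s` reaches `p`. -/
def Active (α : ℝ) (T : ℕ) (p : ℝ) {t : ℕ} (h : History n t) (s : Finset (Fin n)) : Prop :=
  ∃ i ∉ s, (p : EReal) ≤ ucb α T h i

open Classical in
/-- The shortfall of the reward of arm `i` with respect to the level `p` in a round in which arm `i`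
is selected and the level is active. -/
noncomputable def shortfall (α : ℝ) (T : ℕ) (p : ℝ) (i : Fin n) {t : ℕ} (h : History n t)
    (r : Round n) : ℝ :=
  if Active α T p h r.1 ∧ i ∈ r.1 then p - r.reward i else 0

/-- The total shortfall of arm `i` with respect to the level `p`. -/
noncomputable def totalShortfall (α : ℝ) (T : ℕ) (p : ℝ) (i : Fin n) :
    (t : ℕ) → History n t → ℝ
  | 0, _ => 0
  | t + 1, h => totalShortfall α T p i t (Fin.init h) +
      shortfall α T p i (Fin.init h) (h (Fin.last t))

lemma totalShortfall_snoc (α : ℝ) (T : ℕ) (p : ℝ) (i : Fin n) {t : ℕ} (h : History n t)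
    (r : Round n) :
    totalShortfall α T p i (t + 1) (Fin.snoc h r) =
      totalShortfall α T p i t h + shortfall α T p i h r := by
  simp [totalShortfall]

/-- The largest index of an unselected arm never increases. -/
lemma Active.of_snoc {α : ℝ} {k T : ℕ} {p : ℝ} {t : ℕ} {h : History n t} {r : Round n}
    {s : Finset (Fin n)} (hr : r.1 ∈ feasible n k)
    (hs : IsTopK k (ucb α T (Fin.snoc h r : History n (t + 1))) s)
    (hact : Active α T p (Fin.snoc h r : History n (t + 1)) s) : Active α T p h r.1 := by
  obtain ⟨j, hj, hpj⟩ := hact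
  by_cases hjr : j ∈ r.1
  -- If the witness `j` was just played, its index may have risen. But some `i` in `s` was then not
  -- played; its index is unchanged and, by the top-`k` property, at least that of `j`.
  · have hcard : r.1.card = s.card :=
      (Finset.mem_powersetCard.1 hr).2.trans (Finset.mem_powersetCard.1 hs.1).2.symm
    obtain ⟨i, his, hir⟩ : ∃ i ∈ s, i ∉ r.1 := by
      by_contra! hsub
      exact hj (Finset.eq_of_subset_of_card_le hsub hcard.le ▸ hjr)
    exact ⟨i, hir, by simpa [ucb_snoc_of_notMem α T h hir] using hpj.trans (hs.2 i his j hj)⟩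
  · exact ⟨j, hjr, by simpa [ucb_snoc_of_notMem α T h hjr] using hpj⟩

lemma level_mul_numPulls_le {α : ℝ} {T : ℕ} {p : ℝ} {t : ℕ} {h : History n t} {i : Fin n}
    (hp : (p : EReal) ≤ ucb α T h i) :
    p * numPulls h i - cumReward h i ≤ √(α * Real.log T * numPulls h i) := by
  by_cases hN : numPulls h i = 0
  · simp [hN, cumReward_nonneg]
  · have hN' : (0 : ℝ) < numPulls h i := by exact_mod_cast Nat.pos_of_ne_zero hN
    rw [ucb, if_neg hN, EReal.coe_le_coe_iff] at hp
    have h1 := mul_le_mul_of_nonneg_right hp hN'.le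
    have h2 : √(α * Real.log T / numPulls h i) * numPulls h i =
        √(α * Real.log T * numPulls h i) := by
      rw [← Real.sqrt_sq hN'.le, ← Real.sqrt_mul' _ (by positivity), Real.sqrt_sq hN'.le]
      congr 1
      field_simp
    rw [add_mul, h2, div_mul_cancel₀ _ hN'.ne'] at h1
    linarith

/-- The second conjunct is the invariant driving the induction: either the level has been active
throughout, so the shortfall is exactly `p * N - C`, or it can never become active again and the
shortfall is frozen. In the first case the index bound before the current round controls all but the
newest reward. -/
lemma totalShortfall_le {α : ℝ} {k T : ℕ} {p : ℝ} (hp : p ≤ 1) (hα : 1 ≤ α * Real.log T)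
    {t : ℕ} {h : History n t} (hh : FollowsUCB α k T t h) :
    (∀ i, totalShortfall α T p i t h ≤ 2 * √(α * Real.log T * numPulls h i)) ∧
      ((∀ i, totalShortfall α T p i t h = p * numPulls h i - cumReward h i) ∨
        ∀ s, IsTopK k (ucb α T h) s → ¬ Active α T p h s) := by
  induction t with
  | zero => simp [totalShortfall, numPulls, cumReward]
  | succ t ih =>
    obtain ⟨h, r, rfl⟩ : ∃ h' r, h = Fin.snoc h' r := ⟨Fin.init h, h (Fin.last t), by simp⟩
    obtain ⟨hh, hr⟩ := followsUCB_snoc.1 hh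
    obtain ⟨ih1, ih2⟩ := ih hh
    have hmono : ∀ i, √(α * Real.log T * numPulls h i) ≤
        √(α * Real.log T * numPulls (Fin.snoc h r : History n (t + 1)) i) := fun i => by
      refine Real.sqrt_le_sqrt (mul_le_mul_of_nonneg_left ?_ (by linarith))
      rw [numPulls_snoc]
      push_cast
      split_ifs <;> simp
    by_cases hact : Active α T p h r.1
    · have heq := ih2.resolve_right fun hn => hn _ hr hact
      obtain ⟨j, hj, hpj⟩ := hact
      have heq' : ∀ i, totalShortfall α T p i (t + 1) (Fin.snoc h r) =
          p * numPulls (Fin.snoc h r : History n (t + 1)) i -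
            cumReward (Fin.snoc h r : History n (t + 1)) i := fun i => by
        rw [totalShortfall_snoc, heq, shortfall, numPulls_snoc, cumReward_snoc]
        by_cases hi : i ∈ r.1
        · rw [if_pos ⟨⟨j, hj, hpj⟩, hi⟩, if_pos hi]
          push_cast
          ring
        · rw [if_neg fun hc => hi hc.2, if_neg hi, reward_of_notMem hi]
          simp
      refine ⟨fun i => ?_, Or.inl heq'⟩
      by_cases hi : i ∈ r.1
      · have h1 := level_mul_numPulls_le (hpj.trans (hr.2 i hi j hj))
        -- The newest round adds at most `p ≤ 1`; this pays for it and accounts for the factor 2.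
        have h2 : 1 ≤ √(α * Real.log T * numPulls (Fin.snoc h r : History n (t + 1)) i) := by
          rw [Real.one_le_sqrt, numPulls_snoc, if_pos hi]
          push_cast
          nlinarith [Nat.cast_nonneg (α := ℝ) (numPulls h i)]
        have h3 := hmono i
        have h4 := (reward_mem_Icc r i).1
        have h5 : ((numPulls (Fin.snoc h r : History n (t + 1)) i : ℕ) : ℝ) =
            numPulls h i + 1 := by
          rw [numPulls_snoc, if_pos hi]
          push_cast
          rfl
        rw [heq', cumReward_snoc]
        nlinarith
      · rw [totalShortfall_snoc, shortfall, if_neg fun hc => hi hc.2]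
        linarith [ih1 i, hmono i]
    · have hzero : ∀ i, shortfall α T p i h r = 0 := fun i => if_neg fun hc => hact hc.1
      refine ⟨fun i => ?_, Or.inr fun s hs hs' => hact (hs'.of_snoc hr.1 hs)⟩
      rw [totalShortfall_snoc, hzero]
      linarith [ih1 i, hmono i]

lemma sum_totalShortfall_le {α : ℝ} {k T : ℕ} {p : ℝ} (hp : p ≤ 1)
    (hα : 1 ≤ α * Real.log T) {t : ℕ} {h : History n t} (hh : FollowsUCB α k T t h)
    (A : Finset (Fin n)) :
    ∑ i ∈ A, totalShortfall α T p i t h ≤ 2 * √(α * Real.log T * (n * (k * t))) := by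
  calc ∑ i ∈ A, totalShortfall α T p i t h
      ≤ ∑ i ∈ A, 2 * √(α * Real.log T * numPulls h i) :=
        Finset.sum_le_sum fun i _ => (totalShortfall_le hp hα hh).1 i
    _ ≤ ∑ i, 2 * √(α * Real.log T * numPulls h i) :=
        Finset.sum_le_sum_of_subset_of_nonneg (Finset.subset_univ _) fun _ _ _ => by positivity
    _ = 2 * ∑ i, √(α * Real.log T * numPulls h i) := by rw [Finset.mul_sum]
    _ ≤ 2 * √(α * Real.log T * (n * (k * t))) := by
        refine mul_le_mul_of_nonneg_left (Real.le_sqrt_of_sq_le ?_) zero_le_two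
        refine sq_sum_le_card_mul_sum_sq.trans_eq ?_
        have hsq : ∀ i, √(α * Real.log T * numPulls h i) ^ 2 =
            α * Real.log T * numPulls h i := fun i =>
          Real.sq_sqrt (mul_nonneg (by linarith) (Nat.cast_nonneg _))
        simp only [hsq, ← Finset.mul_sum, ← Nat.cast_sum, sum_numPulls hh, Finset.card_univ,
          Fintype.card_fin]
        push_cast
        ring

/-! ### Probability that an index falls below the mean -/

/-- The exponential supermartingale of the deviation of the rewards of arm `i` below `p`. -/
noncomputable def expDeviation (p l : ℝ) (i : Fin n) {t : ℕ} (h : History n t) : ℝ :=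
  Real.exp (l * (p * numPulls h i - cumReward h i) - l ^ 2 / 8 * numPulls h i)

/-- Whichever set is played, the mean of `i` in it is at least `p`, so replacing `p` by that mean
only increases the exponent, and Hoeffding's lemma is offset by the compensator `l ^ 2 / 8`. -/
lemma expect_expDeviation_snoc_le {D : RewardModel n} {s : Finset (Fin n)} {p l : ℝ} {i : Fin n}
    (hp : i ∈ s → p ≤ D.mean s i) (hl : 0 ≤ l) {t : ℕ} (h : History n t) :
    expect (D s) (fun x => expDeviation p l i (Fin.snoc h ⟨s, x⟩ : History n (t + 1))) ≤
      expDeviation p l i h := by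
  by_cases hi : i ∈ s
  · have key : ∀ x : s → Bool, expDeviation p l i (Fin.snoc h ⟨s, x⟩ : History n (t + 1)) ≤
        expDeviation p l i h * Real.exp (-(l ^ 2 / 8)) *
          Real.exp (l * (D.mean s i - Round.reward ⟨s, x⟩ i)) := fun x => by
      rw [expDeviation, expDeviation, ← Real.exp_add, ← Real.exp_add, Real.exp_le_exp,
        numPulls_snoc, cumReward_snoc, if_pos hi]
      push_cast
      nlinarith [mul_le_mul_of_nonneg_left (hp hi) hl]
    refine (expect_mono _ fun x _ => key x).trans ?_
    rw [expect_const_mul]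
    have h1 := expect_exp_le (D s) (fun x => reward_mem_Icc ⟨s, x⟩ i) l
    refine (mul_le_mul_of_nonneg_left h1 (by unfold expDeviation; positivity)).trans_eq ?_
    rw [mul_assoc, ← Real.exp_add, neg_add_cancel, Real.exp_zero, mul_one]
  · have key : ∀ x : s → Bool, expDeviation p l i (Fin.snoc h ⟨s, x⟩ : History n (t + 1)) =
        expDeviation p l i h := fun x => by
      simp [expDeviation, numPulls_snoc, cumReward_snoc, hi, reward_of_notMem]
    simp only [key, expect_const, le_refl]

lemma expect_expDeviation_le_one {α : ℝ} {k T : ℕ} {D : RewardModel n} {π : Policy n}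
    (hπ : IsUCBAlgorithm α k T π) {p l : ℝ} {i : Fin n}
    (hp : ∀ s ∈ feasible n k, i ∈ s → p ≤ D.mean s i) (hl : 0 ≤ l) {t : ℕ} (ht : t ≤ T) :
    expect (historyLaw D π t) (expDeviation p l i) ≤ 1 := by
  induction t with
  | zero => simp [historyLaw, expect_pure, expDeviation, numPulls, cumReward]
  | succ t ih =>
    rw [expect_historyLaw_succ]
    refine (expect_mono _ fun h _ => ?_).trans (ih (by omega))
    rw [← expect_const (π t h) (expDeviation p l i h)]
    exact expect_mono _ fun s hs =>
      expect_expDeviation_snoc_le (hp s (hπ t (by omega) h s hs).1) hl h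

-- The best tilt depends on the random count `N`, while the supermartingale needs a deterministic
-- one. Hence one term for each possible value `m` of `N`; the term with `m = N` alone is at least 1
-- on the failure event.
open Classical in
lemma ite_ucb_lt_le_sum {α : ℝ} {T : ℕ} (hα : 0 ≤ α * Real.log T) (p : ℝ) (i : Fin n) {t : ℕ}
    (h : History n t) :
    (if ucb α T h i < p then (1 : ℝ) else 0) ≤
      ∑ m ∈ Finset.Icc 1 t, Real.exp (-(2 * (α * Real.log T))) *
        expDeviation p (4 * √(α * Real.log T / m)) i h := by
  have hnn : ∀ m ∈ Finset.Icc 1 t, 0 ≤ Real.exp (-(2 * (α * Real.log T))) *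
      expDeviation p (4 * √(α * Real.log T / m)) i h := fun m _ => by
    unfold expDeviation
    positivity
  split_ifs with hb
  · have hN : numPulls h i ≠ 0 := fun h0 => by simp [ucb, h0] at hb
    rw [ucb, if_neg hN, EReal.coe_lt_coe_iff] at hb
    refine le_trans ?_ (Finset.single_le_sum hnn
      (Finset.mem_Icc.2 ⟨Nat.one_le_iff_ne_zero.2 hN, numPulls_le h i⟩))
    rw [expDeviation, ← Real.exp_add, Real.one_le_exp_iff]
    have hN' : (0 : ℝ) < numPulls h i := by exact_mod_cast Nat.pos_of_ne_zero hN
    set N : ℝ := ((numPulls h i : ℕ) : ℝ)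
    set q := √(α * Real.log T / N) with hq
    have hq2 : q ^ 2 * N = α * Real.log T := by
      rw [hq, Real.sq_sqrt (by positivity), div_mul_cancel₀ _ hN'.ne']
    have h1 : q * N ≤ p * N - cumReward h i := by
      have := mul_le_mul_of_nonneg_right hb.le hN'.le
      rw [add_mul, div_mul_cancel₀ _ hN'.ne'] at this
      linarith
    have h2 := mul_le_mul_of_nonneg_left h1 (Real.sqrt_nonneg (α * Real.log T / N))
    rw [← hq] at h2
    -- With `l = 4 * q`, the exponent is at least `4 * q ^ 2 * N - 2 * q ^ 2 * N = 2 * (α * log T)`,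
    -- cancelling the prefactor.
    nlinarith
  · exact Finset.sum_nonneg hnn

open Classical in
lemma expect_ucb_lt_le {α : ℝ} {k T : ℕ} {D : RewardModel n} {π : Policy n}
    (hα : 0 ≤ α * Real.log T) (hπ : IsUCBAlgorithm α k T π) {p : ℝ} {i : Fin n}
    (hp : ∀ s ∈ feasible n k, i ∈ s → p ≤ D.mean s i) {t : ℕ} (ht : t ≤ T) :
    expect (historyLaw D π t) (fun h => if ucb α T h i < p then (1 : ℝ) else 0) ≤
      t * Real.exp (-(2 * (α * Real.log T))) := by
  refine (expect_mono _ fun h _ => ite_ucb_lt_le_sum hα p i h).trans ?_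
  simp only [expect_sum, expect_const_mul]
  refine (Finset.sum_le_sum (g := fun _ => Real.exp (-(2 * (α * Real.log T)))) fun m _ =>
    mul_le_of_le_one_right (Real.exp_pos _).le
      (expect_expDeviation_le_one hπ hp (by positivity) ht)).trans_eq ?_
  simp

/-! ### Assembling the regret bound -/

lemma expect_shortfall {α : ℝ} {T : ℕ} (D : RewardModel n) (p : ℝ) (i : Fin n) {t : ℕ}
    (h : History n t) (s : Finset (Fin n)) :
    open Classical in
    expect (D s) (fun x => shortfall α T p i h ⟨s, x⟩) =
      if Active α T p h s ∧ i ∈ s then p - D.mean s i else 0 := by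
  classical
  unfold shortfall
  split_ifs with hc
  · rw [expect_sub, expect_const]
    rfl
  · exact expect_const _ _

lemma sum_expect_shortfall (α : ℝ) (T : ℕ) (D : RewardModel n) (π : Policy n) (p : ℝ) (i : Fin n)
    (t : ℕ) :
    ∑ τ ∈ Finset.range t, expect (historyLaw D π (τ + 1))
        (fun h => shortfall α T p i (Fin.init h) (h (Fin.last τ))) =
      expect (historyLaw D π t) (totalShortfall α T p i t) := by
  induction t with
  | zero => simp [historyLaw, expect_pure, totalShortfall]
  | succ t ih =>
    rw [Finset.sum_range_succ, ih, show totalShortfall α T p i (t + 1) = fun h =>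
      totalShortfall α T p i t (Fin.init h) + shortfall α T p i (Fin.init h) (h (Fin.last t))
      from rfl, expect_add]
    congr 1
    rw [expect_historyLaw_succ]
    simp only [Fin.init_snoc, expect_const]

-- The excluded arms depend only on `j`, not on the history or on `s`, so the shortfalls can later
-- be summed over time arm by arm.
open Classical in
lemma value_sub_value_le {k T t : ℕ} {α : ℝ} {D : RewardModel n} {sStar : Finset (Fin n)}
    (hopt : IsOptimal D k sStar) (hcons : WeakOptimalSetConsistency D k sStar)
    (h : History n t) {s : Finset (Fin n)} (hs : s ∈ feasible n k) :
    D.value sStar - D.value s ≤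
      ∑ j ∈ sStar, ∑ i ∈ Finset.univ \ sStar.filter (fun c => D.mean sStar j < D.mean sStar c),
          expect (D s) (fun x => shortfall α T (D.mean sStar j) i h ⟨s, x⟩) +
        k * ∑ c ∈ sStar, if ucb α T h c < D.mean sStar c then (1 : ℝ) else 0 := by
  have hk : sStar.card = k := (Finset.mem_powersetCard.1 hopt.1).2
  have hle := hopt.2 s hs
  rw [value_eq_sum_mean, value_eq_sum_mean] at hle
  have hpx : ∀ c ∈ s ∩ sStar, D.mean sStar c ≤ D.mean s c := fun c hc => by
    by_cases he : s = sStar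
    · rw [he]
    · exact hcons s hs he c hc
  -- A missing optimal arm whose index has not failed is itself a witness that its level is active.
  have hcover : sStar \ s ⊆ sStar.filter (fun j => Active α T (D.mean sStar j) h s) ∪
      sStar.filter (fun c => ucb α T h c < D.mean sStar c) := fun c hc => by
    obtain ⟨hc1, hc2⟩ := Finset.mem_sdiff.1 hc
    rw [Finset.mem_union, Finset.mem_filter, Finset.mem_filter]
    rcases lt_or_ge (ucb α T h c) (D.mean sStar c) with hlt | hge
    · exact Or.inr ⟨hc1, hlt⟩
    · exact Or.inl ⟨hc1, c, hc2, hge⟩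
  have hmain := regret_le_sum_shortfall ((Finset.mem_powersetCard.1 hs).2.trans hk.symm)
    (mean_mem_Icc D sStar) (fun i => (mean_mem_Icc D s i).1) hpx hle (Finset.filter_subset _ _)
    (Finset.filter_subset _ _) hcover
  rw [value_eq_sum_mean, value_eq_sum_mean]
  refine hmain.trans_eq ?_
  rw [hk, Finset.sum_boole, Finset.sum_filter]
  congr 1
  refine Finset.sum_congr rfl fun j _ => ?_
  simp only [expect_shortfall]
  by_cases hact : Active α T (D.mean sStar j) h s
  · simp only [hact, if_true, true_and, ← Finset.sum_filter]
    congr 1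
    ext i
    simp [and_comm]
  · simp [hact]

open Classical in
lemma stepRegret_le {k T t : ℕ} {α : ℝ} {D : RewardModel n} {sStar : Finset (Fin n)}
    {π : Policy n} (hopt : IsOptimal D k sStar) (hcons : WeakOptimalSetConsistency D k sStar)
    (hπ : IsUCBAlgorithm α k T π) (ht : t < T) :
    stepRegret D π sStar t ≤
      ∑ j ∈ sStar, ∑ i ∈ Finset.univ \ sStar.filter (fun c => D.mean sStar j < D.mean sStar c),
          expect (historyLaw D π (t + 1))
            (fun h => shortfall α T (D.mean sStar j) i (Fin.init h) (h (Fin.last t))) +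
        k * ∑ c ∈ sStar, expect (historyLaw D π t)
          (fun h => if ucb α T h c < D.mean sStar c then (1 : ℝ) else 0) := by
  have h1 : stepRegret D π sStar t = expect (historyLaw D π t) fun h =>
      expect (π t h) fun s => D.value sStar - D.value s := by
    simp only [stepRegret, expect_historyLaw_succ, expect_sub, expect_const, Fin.snoc_last,
      RewardModel.value]
  rw [h1]
  simp only [expect_historyLaw_succ, Fin.init_snoc, Fin.snoc_last, ← expect_sum,
    ← expect_const_mul, ← expect_add]
  refine expect_mono _ fun h _ => ?_
  rw [← expect_const (π t h) ((k : ℝ) * _), ← expect_add]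
  refine expect_mono _ fun s hs => ?_
  simpa only [expect_sum] using
    value_sub_value_le (α := α) (T := T) hopt hcons h (hπ t ht h s hs).1

lemma one_le_mul_log {T : ℕ} {α : ℝ} (hT : 2 ≤ T) (hα : 2 ≤ α) : 1 ≤ α * Real.log T := by
  have h1 : Real.log 2 ≤ Real.log T := Real.log_le_log two_pos (by exact_mod_cast hT)
  nlinarith [Real.log_two_gt_d9]

lemma regret_le {k T : ℕ} {α : ℝ} {D : RewardModel n} {sStar : Finset (Fin n)}
    {π : Policy n} (hT : 2 ≤ T) (hα : 2 ≤ α) (hopt : IsOptimal D k sStar)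
    (hcons : WeakOptimalSetConsistency D k sStar) (hπ : IsUCBAlgorithm α k T π) :
    regret D π sStar T ≤ k * (2 * √(α * Real.log T * (n * (k * T)))) + (k : ℝ) ^ 2 := by
  classical
  have hL := one_le_mul_log hT hα
  have hk : sStar.card = k := (Finset.mem_powersetCard.1 hopt.1).2
  refine (Finset.sum_le_sum fun t ht =>
    stepRegret_le hopt hcons hπ (Finset.mem_range.1 ht)).trans ?_
  rw [Finset.sum_add_distrib]
  refine add_le_add ?_ ?_
  · rw [Finset.sum_comm]
    refine (Finset.sum_le_sum (g := fun _ => 2 * √(α * Real.log T * (n * (k * T))))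
      fun j _ => ?_).trans_eq (by simp [hk])
    rw [Finset.sum_comm]
    simp only [sum_expect_shortfall, ← expect_sum]
    rw [← expect_const (historyLaw D π T) (2 * √(α * Real.log T * (n * (k * T))))]
    exact expect_mono _ fun h hh => sum_totalShortfall_le (mean_mem_Icc D sStar j).2 hL
      (followsUCB_of_mem_support hπ le_rfl h hh) _
  · have hT0 : (0 : ℝ) < T := by positivity
    have hexp : Real.exp (-(2 * (α * Real.log T))) ≤ ((T : ℝ) ^ 2)⁻¹ := by
      rw [← Real.exp_log (inv_pos.2 (pow_pos hT0 2)), Real.exp_le_exp, Real.log_inv, Real.log_pow]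
      have : 0 ≤ Real.log T := Real.log_natCast_nonneg T
      push_cast
      nlinarith
    -- Each of the `k` optimal arms fails with probability at most `T * T ^ (-2)` in a round, at
    -- cost `k`; over `T` rounds this totals `k ^ 2`.
    refine (Finset.sum_le_sum (g := fun _ => (k : ℝ) * (k * (T : ℝ)⁻¹)) fun t ht => ?_).trans_eq ?_
    · refine mul_le_mul_of_nonneg_left ?_ (Nat.cast_nonneg k)
      rw [← hk, ← nsmul_eq_mul]
      refine Finset.sum_le_card_nsmul _ _ _ fun c hc => ?_
      have htT := (Finset.mem_range.1 ht).le
      refine (expect_ucb_lt_le (by linarith) hπ (fun s hs hcs => ?_) htT).trans ?_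
      · by_cases he : s = sStar
        · rw [he]
        · exact hcons s hs he c (Finset.mem_inter.2 ⟨hcs, hc⟩)
      · calc (t : ℝ) * Real.exp (-(2 * (α * Real.log T))) ≤ T * ((T : ℝ) ^ 2)⁻¹ := by
              gcongr
          _ = (T : ℝ)⁻¹ := by field_simp
    · rw [Finset.sum_const, Finset.card_range, nsmul_eq_mul]
      field_simp

lemma sqrt_le_sq_natCast (k : ℕ) : √(k : ℝ) ≤ (k : ℝ) ^ 2 := by
  have : (k : ℝ) ≤ (k : ℝ) ^ 4 := by exact_mod_cast Nat.le_self_pow four_ne_zero k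
  exact Real.sqrt_le_iff.2 ⟨by positivity, by nlinarith⟩

end CombBandit

theorem mainTheorem2 :
    ∃ K : ℝ, 0 < K ∧
      ∀ (n k T : ℕ) (α : ℝ) (D : CombBandit.RewardModel n) (sStar : Finset (Fin n))
        (π : CombBandit.Policy n),
        2 ≤ T → 2 ≤ α →
        CombBandit.IsOptimal D k sStar →
        CombBandit.WeakOptimalSetConsistency D k sStar →
        CombBandit.IsUCBAlgorithm α k T π →
        CombBandit.regret D π sStar T ≤
            2 * √(α * k * n * T * Real.log T) + 15 * (k : ℝ) ^ 2 * √(α * n * T * Real.log T) ∧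
          2 * √(α * k * n * T * Real.log T) + 15 * (k : ℝ) ^ 2 * √(α * n * T * Real.log T) ≤
            K * ((k : ℝ) ^ 2 * √(α * n * T * Real.log T)) := by
  -- `17 = 2 + 15`, using `√k ≤ k ^ 2` for the first term.
  refine ⟨17, by norm_num, fun n k T α D sStar π hT hα hopt hcons hπ => ?_⟩
  have hsplit : √(α * k * n * T * Real.log T) = √(k : ℝ) * √(α * n * T * Real.log T) := by
    rw [← Real.sqrt_mul (Nat.cast_nonneg k)]
    congr 1
    ring
  have hsqrt := mul_le_mul_of_nonneg_right (CombBandit.sqrt_le_sq_natCast k)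
    (Real.sqrt_nonneg (α * n * T * Real.log T))
  refine ⟨(CombBandit.regret_le hT hα hopt hcons hπ).trans ?_, by rw [hsplit]; linarith⟩
  rcases Nat.eq_zero_or_pos k with rfl | hk
  · simp
  have hkn : k ≤ n := by
    obtain ⟨-, hcard⟩ := Finset.mem_powersetCard.1 hopt.1
    simpa [hcard] using Finset.card_le_univ sStar
  have hk1 : (1 : ℝ) ≤ k := by exact_mod_cast hk
  have hn1 : (1 : ℝ) ≤ n := by exact_mod_cast hk.trans_le hkn
  have hT1 : (1 : ℝ) ≤ T := by exact_mod_cast one_le_two.trans hT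
  have h1 : 1 ≤ √(α * n * T * Real.log T) := by
    rw [Real.one_le_sqrt, show α * n * T * Real.log T = α * Real.log T * (n * T) by ring]
    exact one_le_mul_of_one_le_of_one_le (CombBandit.one_le_mul_log hT hα)
      (one_le_mul_of_one_le_of_one_le hn1 hT1)
  have h2 : √(α * Real.log T * (n * (k * T))) = √(k : ℝ) * √(α * n * T * Real.log T) := by
    rw [← hsplit]
    congr 1
    ring
  have h3 : √(k : ℝ) ≤ k := Real.sqrt_le_iff.2 ⟨by linarith, by nlinarith⟩
  have h4 : (k : ℝ) * (2 * √(α * Real.log T * (n * (k * T)))) ≤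
      2 * ((k : ℝ) ^ 2 * √(α * n * T * Real.log T)) := by
    rw [h2]
    have := mul_le_mul_of_nonneg_left
      (mul_le_mul_of_nonneg_right h3 (Real.sqrt_nonneg (α * n * T * Real.log T)))
      (Nat.cast_nonneg (α := ℝ) k)
    linarith
  have h5 : (k : ℝ) ^ 2 ≤ (k : ℝ) ^ 2 * √(α * n * T * Real.log T) :=
    le_mul_of_one_le_right (by positivity) h1
  have h6 : 0 ≤ √(α * k * n * T * Real.log T) := Real.sqrt_nonneg _
  -- By `h4` and `h5` the regret is at most `3 * k ^ 2 * √(α * n * T * log T)`, well inside the term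
  -- with constant 15.
  nlinarith
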